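/- Let $\mathbb D$ be the open unit disc and let $(\phi_t)_{t\ge 0}$ be a continuous one-parameter semigroup of holomorphic self-maps of $\mathbb D$ (that is, $\phi_0=\mathrm{id}$, $\phi_{s+t}=\phi_s\circ\phi_t$, and $t\mapsto\phi_t$ is continuous for uniform convergence on compacta). Assume it is non-elliptic with Denjoy–Wolff point $\tau\in\partial\mathbb D$, i.e. $\phi_t\to\tau$ uniformly on compacta of $\mathbb D$ as $t\to+\infty$. Let $h$ be its Koenigs function, i.e. the univalent function on $\mathbb D$ (unique up to an additive constant) with $h(\phi_t(z))=h(z)+it$ for all $t\ge0$, $z\in\mathbb D$, and let $\Omega=h(\mathbb D)$. For $\beta\in(0,\pi/2)$ put $V(\beta,0)=\{\rho e^{i\theta}:\rho>0,\ |\theta|<\beta\}$. Suppose that there are $\beta\in(0,\pi/2)$ and $q\in\mathbb C$ with $q+iV(\beta,0)\subset\Omega$. Then for every $z\in\mathbb D$ the trajectory $\phi_t(z)$ converges non-tangentially to $\tau$ as $t\to+\infty$, that is, $\phi_t(z)\to\tau$ and, for some $R>1$ (depending on $z$), $|\tau-\phi_t(z)|<R(1-|\phi_t(z)|)$ for all sufficiently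 large $t$. Moreover, the slope of $(\phi_t)$ is a compact interval $[a,b]$ with $-\pi/2<a\le b<\pi/2$: there are such $a,b$ for which, for every $z\in\mathbb D$, the set of cluster points of $\mathrm{Arg}(1-\overline{\tau}\phi_t(z))$ as $t\to+\infty$ equals $[a,b]$. -/

import Mathlib

open scoped NNReal

namespace DiscSemigroup

open Filter Topology

/-- The open unit disc of `ℂ`. -/
abbrev disc : Set ℂ := Metric.ball (0 : ℂ) 1

/-- `φ` (restricted to the unit disc) is a one-parameter continuous semigroup of holomorphic
self-maps of the unit disc: a homomorphism from `([0,+∞), +)` to the holomorphic self-maps of the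
disc under composition, continuous for the topology of uniform convergence on compacta. -/
structure IsSemigroup (φ : ℝ≥0 → ℂ → ℂ) : Prop where
  holo : ∀ t, DifferentiableOn ℂ (φ t) disc
  mapsTo : ∀ t, Set.MapsTo (φ t) disc disc
  zero : ∀ z ∈ disc, φ 0 z = z
  add : ∀ s t, ∀ z ∈ disc, φ (s + t) z = φ s (φ t z)
  cont : ∀ t₀, TendstoLocallyUniformlyOn φ (φ t₀) (𝓝 t₀) disc

/-- `τ` is the Denjoy–Wolff point of `(φ_t)`: a point of the closed unit disc such that
`φ_t → τ` uniformly on compact subsets of the disc as `t → +∞`. -/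
def IsDenjoyWolffPoint (φ : ℝ≥0 → ℂ → ℂ) (τ : ℂ) : Prop :=
  τ ∈ Metric.closedBall (0 : ℂ) 1 ∧ TendstoLocallyUniformlyOn φ (fun _ => τ) atTop disc

/-- The semigroup is non-elliptic: its Denjoy–Wolff point lies on the unit circle. -/
def IsNonElliptic (φ : ℝ≥0 → ℂ → ℂ) : Prop :=
  ∃ τ ∈ Metric.sphere (0 : ℂ) 1, IsDenjoyWolffPoint φ τ

/-- `h` is a Koenigs function of the (non-elliptic) semigroup `(φ_t)`: `h` is univalent on the disc
and `h ∘ φ_t = h + i t`. Such an `h` is unique up to an additive constant. That the image is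
starlike at infinity, and that the union of its translates by `- i t` is a vertical strip, a
vertical half-plane or the whole plane, follows from these conditions. -/
structure IsKoenigs (φ : ℝ≥0 → ℂ → ℂ) (h : ℂ → ℂ) : Prop where
  holo : DifferentiableOn ℂ h disc
  inj : Set.InjOn h disc
  conj : ∀ t : ℝ≥0, ∀ z ∈ disc, h (φ t z) = h z + Complex.I * ((t : ℝ) : ℂ)

/-- The horizontal sector `V(β, r₀) = {ρ e^{iθ} : ρ > r₀, |θ| < β}`. -/
def sector (β r₀ : ℝ) : Set ℂ :=
  {w | ∃ ρ θ : ℝ, r₀ < ρ ∧ |θ| < β ∧ w = (ρ : ℂ) * Complex.exp (Complex.I * (θ : ℂ))}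

/-- The Stolz region of vertex `σ` and amplitude `R`. -/
def stolz (σ : ℂ) (R : ℝ) : Set ℂ :=
  {z | z ∈ disc ∧ ‖σ - z‖ < R * (1 - ‖z‖)}

/-- The curve `γ` converges non-tangentially to the point `σ` of the unit circle as `t → +∞`. -/
def TendsToNonTangentially (γ : ℝ≥0 → ℂ) (σ : ℂ) : Prop :=
  σ ∈ Metric.sphere (0 : ℂ) 1 ∧ Tendsto γ atTop (𝓝 σ) ∧
    ∃ R : ℝ, 1 < R ∧ ∀ᶠ t in atTop, γ t ∈ stolz σ R

/-- The slope of the trajectory of `z`: the cluster set of `Arg (1 - τ̄ φ_t(z))` as `t → +∞`. -/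
def slope (φ : ℝ≥0 → ℂ → ℂ) (τ z : ℂ) : Set ℝ :=
  {a | MapClusterPt a atTop (fun t : ℝ≥0 => Complex.arg (1 - (starRingEnd ℂ) τ * φ t z))}

end DiscSemigroup

namespace DiscSemigroup

open Filter Topology ComplexConjugate Metric

/-! The Cayley transform at `τ` carries the orbit to a curve `G` in the right half-plane tending to
infinity. Non-tangential convergence means that `‖G‖ ≤ K * re G` eventually, and three facts give
this. Wolff's lemma makes `re G` nondecreasing (`IsSemigroup.cayley_re_mono`). The sector in the
Koenigs domain provides discs of radius proportional to `t` about `h z + i t`, so by Schwarz-Pick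
multiplying `t` by a fixed factor moves `G` a bounded hyperbolic distance. Finally, the domain omits
a point, hence a downward half-line; comparison with the slit plane through a square root shows that
the hyperbolic displacement from time `t` to `M t` grows at least like `log M`
(`IsKoenigs.orbit_lower_bound`). If `re G` failed to double over `n` multiplicative steps, the
displacement would be at most linear in `n` relative to `re G`, which contradicts the exponential
lower bound for large `n`. So `re G` grows geometrically and dominates the sum of the steps
(`exists_norm_le_mul_re`). For the slope, two orbits at equal times stay at fixed Euclidean distance
in the Koenigs domain while the discs grow, so their arguments are asymptotic
(`IsKoenigs.tendsto_arg_sub`); continuity makes the common cluster set an interval. -/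

/-! ### Schwarz-Pick inequalities, written without denominators. -/

theorem norm_add_conj_sq (a b : ℂ) :
    ‖a + conj b‖ ^ 2 = ‖a - b‖ ^ 2 + 4 * a.re * b.re := by
  simp only [Complex.sq_norm, Complex.normSq_apply, Complex.add_re, Complex.add_im,
    Complex.sub_re, Complex.sub_im, Complex.conj_re, Complex.conj_im]
  ring

theorem norm_one_sub_conj_mul_sq (z w : ℂ) :
    ‖1 - conj w * z‖ ^ 2 = ‖z - w‖ ^ 2 + (1 - ‖z‖ ^ 2) * (1 - ‖w‖ ^ 2) := by
  simp only [Complex.sq_norm, Complex.normSq_apply, Complex.sub_re, Complex.sub_im,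
    Complex.mul_re, Complex.mul_im, Complex.conj_re, Complex.conj_im, Complex.one_re,
    Complex.one_im]
  ring

theorem one_sub_norm_sq_pos {z : ℂ} (hz : z ∈ disc) : 0 < 1 - ‖z‖ ^ 2 := by
  have h1 : ‖z‖ < 1 := by simpa using hz
  nlinarith [norm_nonneg z]

theorem norm_one_sub_conj_mul_pos {z w : ℂ} (hz : z ∈ disc) (hw : w ∈ disc) :
    0 < ‖1 - conj w * z‖ := by
  have h1 := norm_one_sub_conj_mul_sq z w
  have h2 := mul_pos (one_sub_norm_sq_pos hz) (one_sub_norm_sq_pos hw)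
  by_contra h3
  have h4 : ‖1 - conj w * z‖ = 0 := le_antisymm (not_lt.1 h3) (norm_nonneg _)
  rw [h4] at h1
  nlinarith [sq_nonneg ‖z - w‖]

theorem norm_sub_lt_norm_add_conj {a b : ℂ} (ha : 0 < a.re) (hb : 0 < b.re) :
    ‖a - b‖ < ‖a + conj b‖ := by
  have h1 := norm_add_conj_sq a b
  have h2 := mul_pos ha hb
  exact lt_of_pow_lt_pow_left₀ 2 (norm_nonneg _) (by nlinarith)

/-- Schwarz lemma for maps from a disc to the right half-plane. -/
theorem norm_sub_le_of_mapsTo_re_pos {F : ℂ → ℂ} {c : ℂ} {R : ℝ}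
    (hF : DifferentiableOn ℂ F (ball c R)) (hpos : ∀ w ∈ ball c R, 0 < (F w).re)
    {w : ℂ} (hw : w ∈ ball c R) :
    ‖F w - F c‖ * R ≤ ‖w - c‖ * ‖F w + conj (F c)‖ := by
  have hR : 0 < R := nonempty_ball.1 ⟨w, hw⟩
  have hc := hpos c (mem_ball_self hR)
  have hden : ∀ w ∈ ball c R, F w + conj (F c) ≠ 0 := by
    intro w hw h0
    have := congrArg Complex.re h0
    simp only [Complex.add_re, Complex.conj_re, Complex.zero_re] at this
    linarith [hpos w hw]
  have hd : DifferentiableOn ℂ (fun w => (F w - F c) / (F w + conj (F c))) (ball c R) :=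
    (hF.sub_const _).div (hF.add_const _) hden
  have hm : Set.MapsTo (fun w => (F w - F c) / (F w + conj (F c))) (ball c R)
      (closedBall ((fun w => (F w - F c) / (F w + conj (F c))) c) 1) := by
    intro v hv
    simp only [sub_self, zero_div, mem_closedBall_zero_iff, norm_div]
    exact div_le_one_of_le₀ (norm_sub_lt_norm_add_conj (hpos v hv) hc).le (norm_nonneg _)
  have := Complex.dist_le_div_mul_dist_of_mapsTo_ball hd hm hw
  simp only [sub_self, zero_div, dist_eq_norm, sub_zero] at this
  rw [norm_div] at this
  have h2 : 0 < ‖F w + conj (F c)‖ := norm_pos_iff.2 (hden w hw)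
  rw [div_le_iff₀ h2] at this
  calc _ ≤ (1 / R * ‖w - c‖ * ‖F w + conj (F c)‖) * R := by gcongr
    _ = _ := by field_simp

/-- The triangle inequality removes `F w` from the right-hand side of the Schwarz bound, so the
displacement is controlled by the real part at the centre alone. -/
theorem norm_sub_mul_le_of_mapsTo_re_pos {F : ℂ → ℂ} {c : ℂ} {R : ℝ}
    (hF : DifferentiableOn ℂ F (ball c R)) (hpos : ∀ w ∈ ball c R, 0 < (F w).re)
    {w : ℂ} (hw : w ∈ ball c R) :
    ‖F w - F c‖ * (R - ‖w - c‖) ≤ 2 * ‖w - c‖ * (F c).re := by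
  have hR : 0 < R := nonempty_ball.1 ⟨w, hw⟩
  have hc := hpos c (mem_ball_self hR)
  have h1 := norm_sub_le_of_mapsTo_re_pos hF hpos hw
  have h2 : ‖F w + conj (F c)‖ ≤ ‖F w - F c‖ + 2 * (F c).re := by
    have : F w + conj (F c) = (F w - F c) + ((2 * (F c).re : ℝ) : ℂ) := by
      rw [← Complex.add_conj]; ring
    rw [this]
    refine (norm_add_le _ _).trans ?_
    rw [Complex.norm_real, Real.norm_of_nonneg (by linarith)]
  nlinarith [mul_le_mul_of_nonneg_left h2 (norm_nonneg (w - c))]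

/-- Schwarz-Pick lemma for maps from the unit disc to the right half-plane. -/
theorem schwarzPick_re_pos {f : ℂ → ℂ} (hf : DifferentiableOn ℂ f disc)
    (hpos : ∀ z ∈ disc, 0 < (f z).re) {z w : ℂ} (hz : z ∈ disc) (hw : w ∈ disc) :
    ‖f z - f w‖ ^ 2 * ((1 - ‖z‖ ^ 2) * (1 - ‖w‖ ^ 2)) ≤
      4 * (f z).re * (f w).re * ‖z - w‖ ^ 2 := by
  have hnw : -w ∈ disc := by simpa using hw
  have hden : ∀ ζ ∈ disc, 1 + conj w * ζ ≠ 0 := by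
    intro ζ hζ
    have := norm_one_sub_conj_mul_pos hζ hnw
    rw [map_neg, neg_mul, sub_neg_eq_add] at this
    exact norm_pos_iff.1 this
  have hmap : Set.MapsTo (fun ζ => (ζ + w) / (1 + conj w * ζ)) disc disc := by
    intro ζ hζ
    have h1 := norm_one_sub_conj_mul_sq ζ (-w)
    have h2 := mul_pos (one_sub_norm_sq_pos hζ) (one_sub_norm_sq_pos hnw)
    rw [map_neg, neg_mul, sub_neg_eq_add, sub_neg_eq_add] at h1
    simp only [mem_ball_zero_iff, norm_div]
    rw [div_lt_one (norm_pos_iff.2 (hden ζ hζ))]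
    exact lt_of_pow_lt_pow_left₀ 2 (norm_nonneg _) (by linarith)
  have hd : DifferentiableOn ℂ (fun ζ => (ζ + w) / (1 + conj w * ζ)) disc :=
    DifferentiableOn.div (by fun_prop) (by fun_prop) hden
  have hzw : 0 < ‖1 - conj w * z‖ := norm_one_sub_conj_mul_pos hz hw
  have hww : 0 < ‖1 - conj w * w‖ := norm_one_sub_conj_mul_pos hw hw
  have hzw' := norm_pos_iff.1 hzw
  have hww' := norm_pos_iff.1 hww
  have hid := norm_one_sub_conj_mul_sq z w
  have hpp := mul_pos (one_sub_norm_sq_pos hz) (one_sub_norm_sq_pos hw)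
  have hζ : (z - w) / (1 - conj w * z) ∈ disc := by
    simp only [mem_ball_zero_iff, norm_div]
    rw [div_lt_one hzw]
    exact lt_of_pow_lt_pow_left₀ 2 hzw.le (by linarith)
  -- The disc automorphism moves `0` to `w`, and the chosen point is the preimage of `z`.
  have key := norm_sub_le_of_mapsTo_re_pos (F := f ∘ fun ζ => (ζ + w) / (1 + conj w * ζ))
    (hf.comp hd hmap) (fun ζ hζ => hpos _ (hmap hζ)) hζ
  have e1 : ((z - w) / (1 - conj w * z) + w) / (1 + conj w * ((z - w) / (1 - conj w * z))) = z := by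
    have h3 : 1 + conj w * ((z - w) / (1 - conj w * z)) = (1 - conj w * w) / (1 - conj w * z) := by
      field_simp; ring
    rw [h3, div_eq_iff (div_ne_zero hww' hzw'), div_add' _ _ _ hzw', mul_div_assoc',
      div_left_inj' hzw']
    ring
  simp only [Function.comp_apply, e1, zero_add, mul_zero, add_zero, div_one, sub_zero, mul_one,
    norm_div] at key
  rw [div_mul_eq_mul_div, le_div_iff₀ hzw] at key
  have k2 := pow_le_pow_left₀ (by positivity) key 2
  rw [mul_pow, mul_pow, hid, norm_add_conj_sq] at k2
  linarith

/-! ### The half-plane model. -/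

/-- The Cayley transform of the unit disc onto the right half-plane sending `σ` to infinity. -/
noncomputable def cayley (σ z : ℂ) : ℂ := (1 + conj σ * z) / (1 - conj σ * z)

theorem one_sub_conj_mul_ne_zero {σ z : ℂ} (hσ : ‖σ‖ = 1) (hz : z ∈ disc) :
    1 - conj σ * z ≠ 0 := by
  intro h0
  have h1 : ‖conj σ * z‖ = 1 := by rw [← sub_eq_zero.1 h0, norm_one]
  rw [norm_mul, RCLike.norm_conj, hσ, one_mul] at h1
  have : ‖z‖ < 1 := by simpa using hz
  linarith

theorem norm_one_sub_conj_mul {σ : ℂ} (hσ : ‖σ‖ = 1) (z : ℂ) : ‖1 - conj σ * z‖ = ‖σ - z‖ := by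
  have h := norm_one_sub_conj_mul_sq z σ
  rw [hσ, one_pow, sub_self, mul_zero, add_zero, norm_sub_rev z σ] at h
  exact (pow_left_inj₀ (norm_nonneg _) (norm_nonneg _) two_ne_zero).1 h

theorem cayley_re {σ : ℂ} (hσ : ‖σ‖ = 1) (z : ℂ) :
    (cayley σ z).re = (1 - ‖z‖ ^ 2) / ‖σ - z‖ ^ 2 := by
  have h1 : (cayley σ z).re = (1 - ‖conj σ * z‖ ^ 2) / ‖1 - conj σ * z‖ ^ 2 := by
    simp only [cayley, Complex.div_re, Complex.sq_norm]
    rw [← add_div]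
    congr 1
    simp only [Complex.normSq_apply, Complex.add_re, Complex.sub_re, Complex.add_im,
      Complex.sub_im, Complex.one_re, Complex.one_im]
    ring
  rw [h1, norm_one_sub_conj_mul hσ, norm_mul, RCLike.norm_conj, hσ, one_mul]

theorem cayley_re_pos {σ z : ℂ} (hσ : ‖σ‖ = 1) (hz : z ∈ disc) : 0 < (cayley σ z).re := by
  rw [cayley_re hσ, ← norm_one_sub_conj_mul hσ]
  have := norm_pos_iff.2 (one_sub_conj_mul_ne_zero hσ hz)
  have := one_sub_norm_sq_pos hz
  positivity

theorem norm_cayley_sub_sq {σ z w : ℂ} (hσ : ‖σ‖ = 1) (hz : z ∈ disc) (hw : w ∈ disc) :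
    ‖cayley σ z - cayley σ w‖ ^ 2 = 4 * ‖z - w‖ ^ 2 / (‖σ - z‖ ^ 2 * ‖σ - w‖ ^ 2) := by
  have h1 := one_sub_conj_mul_ne_zero hσ hz
  have h2 := one_sub_conj_mul_ne_zero hσ hw
  have : cayley σ z - cayley σ w =
      2 * conj σ * (z - w) / ((1 - conj σ * z) * (1 - conj σ * w)) := by
    unfold cayley
    field_simp
    ring
  rw [this, norm_div, norm_mul, norm_mul, norm_mul, RCLike.norm_conj, hσ,
    norm_one_sub_conj_mul hσ, norm_one_sub_conj_mul hσ, Complex.norm_ofNat, div_pow]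
  ring

theorem differentiableOn_cayley {σ : ℂ} (hσ : ‖σ‖ = 1) : DifferentiableOn ℂ (cayley σ) disc :=
  DifferentiableOn.div (by fun_prop) (by fun_prop) fun _ hz => one_sub_conj_mul_ne_zero hσ hz

/-- The hyperbolic distance of the disc, expressed through the Cayley transform. -/
theorem norm_cayley_sub_sq_mul {σ z w : ℂ} (hσ : ‖σ‖ = 1) (hz : z ∈ disc) (hw : w ∈ disc) :
    ‖cayley σ z - cayley σ w‖ ^ 2 * ((1 - ‖z‖ ^ 2) * (1 - ‖w‖ ^ 2)) =
      4 * ‖z - w‖ ^ 2 * ((cayley σ z).re * (cayley σ w).re) := by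
  have h1 := norm_pos_iff.2 (one_sub_conj_mul_ne_zero hσ hz)
  have h2 := norm_pos_iff.2 (one_sub_conj_mul_ne_zero hσ hw)
  rw [norm_one_sub_conj_mul hσ] at h1 h2
  rw [norm_cayley_sub_sq hσ hz hw, cayley_re hσ, cayley_re hσ]
  field_simp

/-- Schwarz-Pick lemma for self-maps of the unit disc. -/
theorem schwarzPick_disc {f : ℂ → ℂ} (hf : DifferentiableOn ℂ f disc)
    (hm : Set.MapsTo f disc disc) {z w : ℂ} (hz : z ∈ disc) (hw : w ∈ disc) :
    ‖f z - f w‖ ^ 2 * ((1 - ‖z‖ ^ 2) * (1 - ‖w‖ ^ 2)) ≤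
      ‖z - w‖ ^ 2 * ((1 - ‖f z‖ ^ 2) * (1 - ‖f w‖ ^ 2)) := by
  have h1 : ‖(1 : ℂ)‖ = 1 := norm_one
  have key := schwarzPick_re_pos ((differentiableOn_cayley h1).comp hf hm)
    (fun z hz => cayley_re_pos h1 (hm hz)) hz hw
  simp only [Function.comp_apply] at key
  have e := norm_cayley_sub_sq_mul h1 (hm hz) (hm hw)
  have p1 := one_sub_norm_sq_pos (hm hz)
  have p2 := one_sub_norm_sq_pos (hm hw)
  have r := mul_pos (cayley_re_pos h1 (hm hz)) (cayley_re_pos h1 (hm hw))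
  have k2 := mul_le_mul_of_nonneg_right key (mul_pos p1 p2).le
  refine le_of_mul_le_mul_right ?_ (mul_pos (zero_lt_four' ℝ) r)
  calc _ = (‖cayley 1 (f z) - cayley 1 (f w)‖ ^ 2 * ((1 - ‖f z‖ ^ 2) * (1 - ‖f w‖ ^ 2))) *
        ((1 - ‖z‖ ^ 2) * (1 - ‖w‖ ^ 2)) := by rw [e]; ring
    _ ≤ _ := by linarith

/-- Comparison of hyperbolic distances under a map from the unit disc to the right half-plane,
in the coordinate of the Cayley transform. -/
theorem schwarzPick_cayley {f : ℂ → ℂ} {σ : ℂ} (hσ : ‖σ‖ = 1) (hf : DifferentiableOn ℂ f disc)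
    (hpos : ∀ z ∈ disc, 0 < (f z).re) {z w : ℂ} (hz : z ∈ disc) (hw : w ∈ disc) :
    ‖f z - f w‖ ^ 2 * ((cayley σ z).re * (cayley σ w).re) ≤
      (f z).re * (f w).re * ‖cayley σ z - cayley σ w‖ ^ 2 := by
  have key := schwarzPick_re_pos hf hpos hz hw
  have e := norm_cayley_sub_sq_mul hσ hz hw
  have p := mul_pos (one_sub_norm_sq_pos hz) (one_sub_norm_sq_pos hw)
  have r := mul_pos (cayley_re_pos hσ hz) (cayley_re_pos hσ hw)
  refine le_of_mul_le_mul_right ?_ p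
  calc _ = (‖f z - f w‖ ^ 2 * ((1 - ‖z‖ ^ 2) * (1 - ‖w‖ ^ 2))) *
        ((cayley σ z).re * (cayley σ w).re) := by ring
    _ ≤ (4 * (f z).re * (f w).re * ‖z - w‖ ^ 2) * ((cayley σ z).re * (cayley σ w).re) := by
        gcongr
    _ = (f z).re * (f w).re * (‖cayley σ z - cayley σ w‖ ^ 2 *
        ((1 - ‖z‖ ^ 2) * (1 - ‖w‖ ^ 2))) := by rw [e]; ring
    _ = _ := by ring

/-! ### Inverses of univalent maps. -/

/-- The inverse of an injective holomorphic map on an open set is holomorphic. -/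
theorem exists_differentiableOn_leftInverse {h : ℂ → ℂ} {U : Set ℂ} (hU : IsOpen U)
    (hd : DifferentiableOn ℂ h U) (hi : Set.InjOn h U) :
    ∃ g : ℂ → ℂ, DifferentiableOn ℂ g (h '' U) ∧ ∀ z ∈ U, g (h z) = z := by
  have hg : ∀ z ∈ U, Function.invFunOn h U (h z) = z := fun z hz =>
    hi.leftInvOn_invFunOn hz
  set g := Function.invFunOn h U
  refine ⟨g, ?_, hg⟩
  have han : ∀ z ∈ U, AnalyticAt ℂ h z := fun z hz => hd.analyticAt (hU.mem_nhds hz)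
  have hnc : ∀ z ∈ U, ¬ ∀ᶠ w in 𝓝 z, h w = h z := by
    intro z hz hc
    have h1 : ∀ᶠ w in 𝓝[≠] z, w = z := by
      filter_upwards [nhdsWithin_le_nhds hc, nhdsWithin_le_nhds (hU.mem_nhds hz)] with w hw hwU
      exact hi hwU hz hw
    obtain ⟨w, hw, hne⟩ := (h1.and self_mem_nhdsWithin).exists
    exact hne hw
  have hopen : ∀ z ∈ U, 𝓝 (h z) ≤ map h (𝓝 z) := fun z hz =>
    (han z hz).eventually_constant_or_nhds_le_map_nhds.resolve_left (hnc z hz)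
  have himg : ∀ z ∈ U, ∀ᶠ w in 𝓝 (h z), w ∈ h '' U := fun z hz =>
    hopen z hz (image_mem_map (hU.mem_nhds hz))
  have hcont : ∀ z ∈ U, ContinuousAt g (h z) := by
    intro z hz N hN
    rw [hg z hz] at hN
    have : h '' (N ∩ U) ∈ 𝓝 (h z) :=
      hopen z hz (image_mem_map (inter_mem hN (hU.mem_nhds hz)))
    refine mem_map.2 (mem_of_superset this ?_)
    rintro _ ⟨v, ⟨hv, hvU⟩, rfl⟩
    simpa only [Set.mem_preimage, hg v hvU] using hv
  have hright : ∀ w ∈ h '' U, h (g w) = w ∧ g w ∈ U := by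
    rintro _ ⟨v, hv, rfl⟩
    rw [hg v hv]
    exact ⟨rfl, hv⟩
  have hderiv : ∀ z ∈ U, deriv h z ≠ 0 → DifferentiableAt ℂ g (h z) := by
    intro z hz hne
    have h1 : HasDerivAt h (deriv h z) (g (h z)) := by
      rw [hg z hz]; exact (han z hz).differentiableAt.hasDerivAt
    exact (h1.of_local_left_inverse (hcont z hz) hne
      ((himg z hz).mono fun w hw => (hright w hw).1)).differentiableAt
  rintro _ ⟨z, hz, rfl⟩
  refine DifferentiableAt.differentiableWithinAt ?_
  -- Removable singularity: zeros of `deriv h` are isolated because `h` is nowhere locally constant,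
  -- and `g` is already continuous by the open mapping theorem.
  refine (Complex.analyticAt_of_differentiable_on_punctured_nhds_of_continuousAt ?_
    (hcont z hz)).differentiableAt
  have hiso : ∀ᶠ v in 𝓝[≠] z, deriv h v ≠ 0 := by
    refine (han z hz).deriv.eventually_eq_zero_or_eventually_ne_zero.resolve_left ?_
    intro h0
    obtain ⟨r, hr, hball⟩ := Metric.eventually_nhds_iff_ball.1 (h0.and (hU.mem_nhds hz))
    refine hnc z hz (Metric.eventually_nhds_iff_ball.2 ⟨r, hr, fun w hw => ?_⟩)
    refine isOpen_ball.is_const_of_deriv_eq_zero (convex_ball z r).isPreconnected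
      (hd.mono fun v hv => (hball v hv).2) (fun v hv => (hball v hv).1) hw (mem_ball_self hr)
  have htend : Tendsto g (𝓝[≠] h z) (𝓝[≠] z) := by
    refine tendsto_nhdsWithin_iff.2 ⟨?_, ?_⟩
    · have := (hcont z hz).tendsto.mono_left (nhdsWithin_le_nhds (s := {h z}ᶜ))
      rwa [hg z hz] at this
    · filter_upwards [nhdsWithin_le_nhds (himg z hz), self_mem_nhdsWithin] with w hw hne hgw
      apply hne
      rw [Set.mem_singleton_iff] at hgw ⊢
      rw [← (hright w hw).1, hgw]
  filter_upwards [htend.eventually hiso, nhdsWithin_le_nhds (himg z hz)] with w hw hwU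
  have := hderiv (g w) (hright w hwU).2 hw
  rwa [(hright w hwU).1] at this

/-! ### Cluster sets of real functions at infinity. -/

/-- The cluster set at infinity of a bounded continuous real function is the interval between its
lower and upper limits. -/
theorem mapClusterPt_atTop_iff {f : ℝ≥0 → ℝ} (hf : Continuous f) {m M : ℝ}
    (hm : ∀ᶠ t in atTop, m ≤ f t) (hM : ∀ᶠ t in atTop, f t ≤ M) (y : ℝ) :
    MapClusterPt y atTop f ↔ y ∈ Set.Icc (liminf f atTop) (limsup f atTop) := by
  have hbl : IsBoundedUnder (· ≥ ·) atTop f := ⟨m, by simpa using hm⟩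
  have hbu : IsBoundedUnder (· ≤ ·) atTop f := ⟨M, by simpa using hM⟩
  have hcl := hbl.isCoboundedUnder_le
  have hcu := hbu.isCoboundedUnder_ge
  rw [mapClusterPt_iff_frequently]
  constructor
  · intro h
    constructor
    · by_contra! hlt
      obtain ⟨r, h1, h2⟩ := exists_between hlt
      have := eventually_lt_of_lt_liminf h2 hbl
      obtain ⟨t, ht, ht'⟩ := ((h (Set.Iio r) (Iio_mem_nhds h1)).and_eventually this).exists
      exact lt_asymm ht ht'
    · by_contra! hlt
      obtain ⟨r, h1, h2⟩ := exists_between hlt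
      have := eventually_lt_of_limsup_lt h1 hbu
      obtain ⟨t, ht, ht'⟩ := ((h (Set.Ioi r) (Ioi_mem_nhds h2)).and_eventually this).exists
      exact lt_asymm ht ht'
  · rintro ⟨hy1, hy2⟩ s hs
    obtain ⟨ε, hε, hball⟩ := Metric.mem_nhds_iff.1 hs
    rw [Real.ball_eq_Ioo] at hball
    have f1 : ∃ᶠ t in atTop, f t < y + ε := frequently_lt_of_liminf_lt hcu (by linarith)
    have f2 : ∃ᶠ t in atTop, y - ε < f t := frequently_lt_of_lt_limsup hcl (by linarith)
    rw [frequently_atTop] at f1 f2 ⊢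
    intro N
    obtain ⟨t₁, ht₁, h1⟩ := f1 N
    obtain ⟨t₂, ht₂, h2⟩ := f2 N
    by_cases c1 : y - ε < f t₁
    · exact ⟨t₁, ht₁, hball ⟨c1, h1⟩⟩
    by_cases c2 : f t₂ < y + ε
    · exact ⟨t₂, ht₂, hball ⟨h2, c2⟩⟩
    obtain ⟨t, ht, hty⟩ := (isPreconnected_Ici (a := N)).intermediate_value
      (Set.mem_Ici.2 ht₁) (Set.mem_Ici.2 ht₂) hf.continuousOn
      (show y ∈ Set.Icc (f t₁) (f t₂) from ⟨by linarith, by linarith⟩)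
    exact ⟨t, ht, hball (by rw [hty]; constructor <;> linarith)⟩

theorem mapClusterPt_of_tendsto_sub {f g : ℝ≥0 → ℝ} (h : Tendsto (fun t => f t - g t) atTop (𝓝 0))
    {y : ℝ} (hy : MapClusterPt y atTop f) : MapClusterPt y atTop g := by
  rw [mapClusterPt_iff_frequently] at hy ⊢
  intro s hs
  obtain ⟨ε, hε, hball⟩ := Metric.mem_nhds_iff.1 hs
  have h1 := hy (ball y (ε / 2)) (ball_mem_nhds _ (by linarith))
  have h2 := h.eventually (ball_mem_nhds (0 : ℝ) (half_pos hε))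
  refine (h1.and_eventually h2).mono fun t ⟨ht1, ht2⟩ => hball ?_
  rw [mem_ball, Real.dist_eq, abs_lt] at *
  constructor <;> linarith [ht1.1, ht1.2, ht2.1, ht2.2]

/-! ### The growth argument for curves in the half-plane. -/

/-- A curve in the right half-plane with nondecreasing real part, which is Lipschitz in the
hyperbolic metric with respect to `log t` and whose hyperbolic displacement grows at least
linearly in `log t`, stays in a sector. -/
theorem exists_norm_le_mul_re {G : ℝ → ℂ} {t₀ l B : ℝ} (ht₀ : 0 < t₀) (hl : 1 < l)
    (hpos : ∀ t, t₀ ≤ t → 0 < (G t).re)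
    (hmono : ∀ s t, t₀ ≤ s → s ≤ t → (G s).re ≤ (G t).re)
    (hstep : ∀ s t, t₀ ≤ t → t ≤ s → s ≤ l * t → ‖G s - G t‖ ≤ 2 * (G t).re)
    (hlow : ∀ M t, 3 ≤ M → t₀ ≤ t →
      M * ((G t).re ^ 2 * (G (M * t)).re ^ 2) ≤ B * ‖G (M * t) - G t‖ ^ 4) :
    ∃ K, 0 < K ∧ ∀ t, t₀ ≤ t → ‖G t‖ ≤ K * (G t).re := by
  have hl0 : 0 < l := by linarith
  have hgrow : ∀ (n : ℕ) t, 0 ≤ t → t ≤ l ^ n * t := fun n t ht =>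
    le_mul_of_one_le_left ht (one_le_pow₀ hl.le)
  have hsum : ∀ (n : ℕ) t, t₀ ≤ t → ‖G (l ^ n * t) - G t‖ ≤ 2 * n * (G (l ^ n * t)).re := by
    intro n t ht
    induction n with
    | zero => simp
    | succ n ih =>
      have h1 : t₀ ≤ l ^ n * t := ht.trans (hgrow n t (by linarith))
      have h2 : l ^ n * t ≤ l ^ (n + 1) * t := by
        rw [pow_succ', mul_assoc]
        exact le_mul_of_one_le_left (by linarith) hl.le
      have h3 := hstep (l ^ (n + 1) * t) (l ^ n * t) h1 h2 (by rw [pow_succ', mul_assoc])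
      have h4 := hmono _ _ h1 h2
      have h5 : ‖G (l ^ (n + 1) * t) - G t‖ ≤
          ‖G (l ^ (n + 1) * t) - G (l ^ n * t)‖ + ‖G (l ^ n * t) - G t‖ := by
        simpa using norm_add_le (G (l ^ (n + 1) * t) - G (l ^ n * t)) (G (l ^ n * t) - G t)
      push_cast
      have : (n : ℝ) * (G (l ^ n * t)).re ≤ n * (G (l ^ (n + 1) * t)).re := by gcongr
      nlinarith
  -- Exponential beats polynomial; `4 * n` is the relative displacement over `n` steps when the real
  -- part does not double.
  obtain ⟨n, hn3, hnB⟩ : ∃ n : ℕ, 3 ≤ l ^ n ∧ |B| * (4 * n) ^ 4 < l ^ n := by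
    have e1 : ∀ᶠ n : ℕ in atTop, 3 ≤ l ^ n :=
      (tendsto_pow_atTop_atTop_of_one_lt hl).eventually_ge_atTop 3
    have e2 := (tendsto_pow_const_div_const_pow_of_one_lt 4 hl).const_mul (|B| * 4 ^ 4)
    rw [mul_zero] at e2
    obtain ⟨n, h1, h2⟩ := (e1.and (e2.eventually (gt_mem_nhds one_pos))).exists
    refine ⟨n, h1, ?_⟩
    rw [← mul_div_assoc, div_lt_one (by positivity)] at h2
    rw [mul_pow]
    linarith
  have hdouble : ∀ t, t₀ ≤ t → 2 * (G t).re ≤ (G (l ^ n * t)).re := by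
    intro t ht
    by_contra! hlt
    have h1 := hlow (l ^ n) t hn3 ht
    have h2 := hsum n t ht
    have h3 := hmono t (l ^ n * t) ht (hgrow n t (by linarith))
    have hx := hpos t ht
    have h4 : ‖G (l ^ n * t) - G t‖ ≤ 4 * n * (G t).re := by
      refine h2.trans ?_
      have : (n : ℝ) * (G (l ^ n * t)).re ≤ n * (2 * (G t).re) := by gcongr
      linarith
    have h5 : ‖G (l ^ n * t) - G t‖ ^ 4 ≤ (4 * n * (G t).re) ^ 4 := by gcongr
    have h6 : B * ‖G (l ^ n * t) - G t‖ ^ 4 ≤ |B| * (4 * n * (G t).re) ^ 4 :=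
      mul_le_mul (le_abs_self B) h5 (by positivity) (abs_nonneg B)
    have h7 : l ^ n * ((G t).re ^ 2 * (G t).re ^ 2) ≤
        l ^ n * ((G t).re ^ 2 * (G (l ^ n * t)).re ^ 2) := by gcongr
    have h8 := mul_lt_mul_of_pos_right hnB (pow_pos hx 4)
    have h9 : l ^ n * (G t).re ^ 4 ≤ |B| * (4 * n) ^ 4 * (G t).re ^ 4 := by
      calc _ = l ^ n * ((G t).re ^ 2 * (G t).re ^ 2) := by ring
        _ ≤ |B| * (4 * n * (G t).re) ^ 4 := h7.trans (h1.trans h6)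
        _ = _ := by ring
    linarith
  -- Induction in blocks of `n`: by doubling, the earlier bound `4 * n * re` costs only `2 * n`
  -- times the new real part, and the last block costs another `2 * n`.
  have hseq : ∀ j : ℕ, ‖G (l ^ j * t₀) - G t₀‖ ≤ 4 * n * (G (l ^ j * t₀)).re := by
    intro j
    induction j using Nat.strong_induction_on with
    | _ j ih =>
      have hj : t₀ ≤ l ^ j * t₀ := hgrow j t₀ ht₀.le
      have hx := hpos _ hj
      rcases le_or_gt n j with hnj | hnj
      · rcases Nat.eq_zero_or_pos n with h0 | hn0
        · subst h0; norm_num at hn3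
        obtain ⟨i, rfl⟩ := Nat.exists_eq_add_of_le hnj
        have hi : t₀ ≤ l ^ i * t₀ := hgrow i t₀ ht₀.le
        have h1 := ih i (by omega)
        have h2 := hsum n (l ^ i * t₀) hi
        have h3 := hdouble (l ^ i * t₀) hi
        rw [← mul_assoc, ← pow_add] at h2 h3
        have h5 : ‖G (l ^ (n + i) * t₀) - G t₀‖ ≤
            ‖G (l ^ (n + i) * t₀) - G (l ^ i * t₀)‖ + ‖G (l ^ i * t₀) - G t₀‖ := by
          simpa using norm_add_le (G (l ^ (n + i) * t₀) - G (l ^ i * t₀)) (G (l ^ i * t₀) - G t₀)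
        have : (n : ℝ) * (2 * (G (l ^ i * t₀)).re) ≤ n * (G (l ^ (n + i) * t₀)).re := by gcongr
        linarith
      · have h2 := hsum j t₀ le_rfl
        have : (j : ℝ) * (G (l ^ j * t₀)).re ≤ n * (G (l ^ j * t₀)).re := by gcongr
        have : 0 ≤ (n : ℝ) * (G (l ^ j * t₀)).re := by positivity
        linarith
  have hx₀ := hpos t₀ le_rfl
  refine ⟨‖G t₀‖ / (G t₀).re + 4 * n + 2, by positivity, fun t ht => ?_⟩
  obtain ⟨j, hj1, hj2⟩ := exists_nat_pow_near ((one_le_div₀ ht₀).2 ht) hl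
  rw [le_div_iff₀ ht₀] at hj1
  rw [div_lt_iff₀ ht₀, pow_succ', mul_assoc] at hj2
  have hj : t₀ ≤ l ^ j * t₀ := hgrow j t₀ ht₀.le
  have h1 := hstep t (l ^ j * t₀) hj hj1 hj2.le
  have h2 := hseq j
  have h3 := hmono _ _ hj hj1
  have h4 := hmono _ _ le_rfl ht
  have h5 : ‖G t‖ ≤ ‖G t - G (l ^ j * t₀)‖ + ‖G (l ^ j * t₀) - G t₀‖ + ‖G t₀‖ := by
    have := norm_add₃_le (a := G t - G (l ^ j * t₀)) (b := G (l ^ j * t₀) - G t₀) (c := G t₀)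
    simpa using this
  have h6 : ‖G t₀‖ ≤ ‖G t₀‖ / (G t₀).re * (G t).re := by
    calc ‖G t₀‖ = ‖G t₀‖ / (G t₀).re * (G t₀).re := by field_simp
      _ ≤ _ := by gcongr
  have h7 : (n : ℝ) * (G (l ^ j * t₀)).re ≤ n * (G t).re := by gcongr
  linarith

/-! ### Wolff's lemma and the geometry of the Koenigs domain. -/

section Semigroup

variable {φ : ℝ≥0 → ℂ → ℂ} {h : ℂ → ℂ} {τ : ℂ}

theorem IsDenjoyWolffPoint.tendsto (hτ : IsDenjoyWolffPoint φ τ) {z : ℂ} (hz : z ∈ disc) :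
    Tendsto (fun t => φ t z) atTop (𝓝 τ) :=
  hτ.2.tendsto_at hz

theorem IsNonElliptic.norm_eq_one (hne : IsNonElliptic φ) (hτ : IsDenjoyWolffPoint φ τ) :
    ‖τ‖ = 1 := by
  obtain ⟨σ, hσ, hσ'⟩ := hne
  have h0 : (0 : ℂ) ∈ disc := mem_ball_self one_pos
  rw [tendsto_nhds_unique (hτ.tendsto h0) (hσ'.tendsto h0)]
  simpa using hσ

theorem IsSemigroup.continuous_orbit (hφ : IsSemigroup φ) {z : ℂ} (hz : z ∈ disc) :
    Continuous fun t => φ t z :=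
  continuous_iff_continuousAt.2 fun t => (hφ.cont t).tendsto_at hz

/-- Wolff's lemma: horodiscs at the Denjoy-Wolff point are invariant. -/
theorem IsSemigroup.norm_sub_sq_mul_le (hφ : IsSemigroup φ) (hτ : IsDenjoyWolffPoint φ τ)
    (hτ1 : ‖τ‖ = 1) (s : ℝ≥0) {z : ℂ} (hz : z ∈ disc) :
    ‖φ s z - τ‖ ^ 2 * (1 - ‖z‖ ^ 2) ≤ ‖z - τ‖ ^ 2 * (1 - ‖φ s z‖ ^ 2) := by
  rcases eq_or_ne s 0 with rfl | hs
  · rw [hφ.zero z hz]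
  have h0 : (0 : ℂ) ∈ disc := mem_ball_self one_pos
  set a : ℕ → ℂ := fun n => φ (n * s) 0 with ha
  have had : ∀ n, a n ∈ disc := fun n => hφ.mapsTo _ h0
  have hsucc : ∀ n, φ s (a n) = a (n + 1) := by
    intro n
    simp only [ha]
    rw [← hφ.add s _ 0 h0]
    congr 1
    push_cast
    ring
  have hat : Tendsto a atTop (𝓝 τ) := by
    refine (hτ.tendsto h0).comp ?_
    exact tendsto_natCast_atTop_atTop.atTop_mul_const (pos_iff_ne_zero.2 hs)
  -- Norms that eventually decrease strictly cannot tend to `1` from inside the disc. Along these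
  -- `n` the factor for `a (n + 1)` in Schwarz-Pick is at most that for `a n`, which then cancels.
  have hfreq : ∃ᶠ n in atTop, ‖a n‖ ≤ ‖a (n + 1)‖ := by
    intro hev
    obtain ⟨N, hN⟩ := eventually_atTop.1 hev
    have hanti : ∀ n, N ≤ n → ‖a n‖ ≤ ‖a N‖ := by
      intro n hn
      induction n, hn using Nat.le_induction with
      | base => exact le_rfl
      | succ n hn ih => exact (not_le.1 (hN n hn)).le.trans ih
    have : ‖τ‖ ≤ ‖a N‖ := le_of_tendsto hat.norm (eventually_atTop.2 ⟨N, hanti⟩)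
    have : ‖a N‖ < 1 := by simpa using had N
    linarith
  have hat' : Tendsto (fun n => a (n + 1)) atTop (𝓝 τ) := hat.comp (tendsto_add_atTop_nat 1)
  have l1 : Tendsto (fun n => ‖φ s z - a (n + 1)‖ ^ 2 * (1 - ‖z‖ ^ 2)) atTop
      (𝓝 (‖φ s z - τ‖ ^ 2 * (1 - ‖z‖ ^ 2))) := ((hat'.const_sub _).norm.pow 2).mul_const _
  have l2 : Tendsto (fun n => ‖z - a n‖ ^ 2 * (1 - ‖φ s z‖ ^ 2)) atTop
      (𝓝 (‖z - τ‖ ^ 2 * (1 - ‖φ s z‖ ^ 2))) := ((hat.const_sub _).norm.pow 2).mul_const _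
  refine le_of_tendsto_of_tendsto_of_frequently l1 l2 (hfreq.mono fun n hn => ?_)
  have key := schwarzPick_disc (hφ.holo s) (hφ.mapsTo s) hz (had n)
  rw [hsucc] at key
  have p1 := one_sub_norm_sq_pos (had n)
  have p2 := one_sub_norm_sq_pos (hφ.mapsTo s hz)
  have h2 : 1 - ‖a (n + 1)‖ ^ 2 ≤ 1 - ‖a n‖ ^ 2 := by gcongr
  refine le_of_mul_le_mul_right ?_ p1
  calc _ = ‖φ s z - a (n + 1)‖ ^ 2 * ((1 - ‖z‖ ^ 2) * (1 - ‖a n‖ ^ 2)) := by ring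
    _ ≤ ‖z - a n‖ ^ 2 * ((1 - ‖φ s z‖ ^ 2) * (1 - ‖a (n + 1)‖ ^ 2)) := key
    _ ≤ ‖z - a n‖ ^ 2 * ((1 - ‖φ s z‖ ^ 2) * (1 - ‖a n‖ ^ 2)) := by gcongr
    _ = _ := by ring

/-- Horodiscs at `τ` are the superlevel sets of the real part of the Cayley transform, so this is
Wolff's lemma in the half-plane. -/
theorem IsSemigroup.cayley_re_mono (hφ : IsSemigroup φ) (hτ : IsDenjoyWolffPoint φ τ)
    (hτ1 : ‖τ‖ = 1) {s t : ℝ≥0} (hst : s ≤ t) {z : ℂ} (hz : z ∈ disc) :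
    (cayley τ (φ s z)).re ≤ (cayley τ (φ t z)).re := by
  obtain ⟨r, rfl⟩ := exists_add_of_le hst
  have hsz := hφ.mapsTo s hz
  have key := hφ.norm_sub_sq_mul_le hτ hτ1 r hsz
  rw [add_comm, hφ.add r s z hz, cayley_re hτ1, cayley_re hτ1]
  have q1 := norm_pos_iff.2 (one_sub_conj_mul_ne_zero hτ1 hsz)
  have q2 := norm_pos_iff.2 (one_sub_conj_mul_ne_zero hτ1 (hφ.mapsTo r hsz))
  rw [norm_one_sub_conj_mul hτ1] at q1 q2
  rw [norm_sub_rev _ τ, norm_sub_rev _ τ] at key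
  rw [div_le_div_iff₀ (by positivity) (by positivity)]
  linarith

/-- The image of a Koenigs function is not the whole plane. -/
theorem IsKoenigs.exists_notMem (hh : IsKoenigs φ h) : ∃ p, p ∉ h '' disc := by
  by_contra! hall
  obtain ⟨g, hg, hgh⟩ := exists_differentiableOn_leftInverse isOpen_ball hh.holo hh.inj
  have huniv : h '' disc = Set.univ := Set.eq_univ_of_forall hall
  rw [huniv, differentiableOn_univ] at hg
  have hb : Bornology.IsBounded (Set.range g) := by
    refine isBounded_ball.subset (t := disc) ?_
    rintro _ ⟨w, rfl⟩
    obtain ⟨z, hz, rfl⟩ := hall w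
    rwa [hgh z hz]
  have h0 : (0 : ℂ) ∈ disc := mem_ball_self one_pos
  have h1 : (1 / 2 : ℂ) ∈ disc := by simp; norm_num
  have := hg.apply_eq_apply_of_bounded hb (h 0) (h (1 / 2))
  rw [hgh 0 h0, hgh _ h1] at this
  norm_num at this

/-- The image of a Koenigs function lies in a plane slit along a downward vertical half-line. -/
theorem IsKoenigs.mem_slitPlane (hφ : IsSemigroup φ) (hh : IsKoenigs φ h) {p : ℂ}
    (hp : p ∉ h '' disc) {z : ℂ} (hz : z ∈ disc) :
    -Complex.I * (h z - p) ∈ Complex.slitPlane := by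
  rw [Complex.mem_slitPlane_iff_not_le_zero]
  intro hle
  obtain ⟨x, hx, hxe⟩ : ∃ x : ℝ, x ≤ 0 ∧ (x : ℂ) = -Complex.I * (h z - p) := by
    rw [Complex.le_def] at hle
    exact ⟨_, hle.1, Complex.ext rfl hle.2.symm⟩
  -- A point directly below `p`, or `p` itself, would flow up to `p` in time `-x`.
  refine hp ⟨φ (-x).toNNReal z, hφ.mapsTo _ hz, ?_⟩
  rw [hh.conj _ z hz, Real.coe_toNNReal _ (by linarith)]
  push_cast
  rw [hxe]
  linear_combination (h z - p) * Complex.I_sq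

theorem re_cpow_half_pos {w : ℂ} (hw : w ∈ Complex.slitPlane) : 0 < (w ^ (1 / 2 : ℂ)).re := by
  have h0 := Complex.slitPlane_ne_zero hw
  have h1 := Complex.neg_pi_lt_arg w
  have h2 := (Complex.arg_le_pi w).lt_of_ne (Complex.mem_slitPlane_iff_arg.1 hw).1
  rw [Complex.cpow_def_of_ne_zero h0, Complex.exp_re]
  refine mul_pos (Real.exp_pos _) (Real.cos_pos_of_mem_Ioo ?_)
  have : (Complex.log w * (1 / 2)).im = w.arg / 2 := by
    rw [show (1 / 2 : ℂ) = ((1 / 2 : ℝ) : ℂ) by norm_num, Complex.im_mul_ofReal, Complex.log_im]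
    ring
  rw [this]
  constructor <;> linarith

theorem cpow_half_sq (w : ℂ) : (w ^ (1 / 2 : ℂ)) ^ 2 = w := by
  rw [one_div]
  exact_mod_cast Complex.cpow_nat_inv_pow w two_ne_zero

/-- Hyperbolic distances along a half-line in a slit plane, seen through the square root. -/
theorem norm_cpow_half_sub_sq_lower {κ : ℂ} {t M : ℝ} (ht : ‖κ‖ ≤ t) (ht0 : 0 < t) (hM : 3 ≤ M) :
    M * ((((M * t : ℝ) + κ) ^ (1 / 2 : ℂ)).re * (((t : ℝ) + κ) ^ (1 / 2 : ℂ)).re) ^ 2 ≤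
      512 * ‖((M * t : ℝ) + κ) ^ (1 / 2 : ℂ) - ((t : ℝ) + κ) ^ (1 / 2 : ℂ)‖ ^ 4 := by
  set a := ((M * t : ℝ) + κ) ^ (1 / 2 : ℂ)
  set b := ((t : ℝ) + κ) ^ (1 / 2 : ℂ)
  have ha : a ^ 2 = (M * t : ℝ) + κ := cpow_half_sq _
  have hb : b ^ 2 = (t : ℝ) + κ := cpow_half_sq _
  have hMt : 0 < M * t := by positivity
  have na : ‖a‖ ^ 2 ≤ (M + 1) * t := by
    rw [← norm_pow, ha]
    refine (norm_add_le _ _).trans ?_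
    rw [Complex.norm_real, Real.norm_of_nonneg hMt.le]
    linarith
  have nb : ‖b‖ ^ 2 ≤ 2 * t := by
    rw [← norm_pow, hb]
    refine (norm_add_le _ _).trans ?_
    rw [Complex.norm_real, Real.norm_of_nonneg ht0.le]
    linarith
  have hprod : ‖a - b‖ * ‖a + b‖ = (M - 1) * t := by
    rw [← norm_mul, show (a - b) * (a + b) = (((M - 1) * t : ℝ) : ℂ) by
      rw [show (a - b) * (a + b) = a ^ 2 - b ^ 2 by ring, ha, hb]; push_cast; ring,
      Complex.norm_real, Real.norm_of_nonneg (mul_nonneg (by linarith) ht0.le)]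
  have hs : ‖a + b‖ ^ 2 ≤ 4 * ((M + 1) * t) := by
    have h1 : ‖a + b‖ ^ 2 ≤ (‖a‖ + ‖b‖) ^ 2 := by gcongr; exact norm_add_le _ _
    have h2 : 2 * t ≤ (M + 1) * t := by gcongr; linarith
    nlinarith [sq_nonneg (‖a‖ - ‖b‖)]
  -- Divide `a ^ 2 - b ^ 2 = (M - 1) * t` by the bound on `a + b`; `3 ≤ M` makes `M + 1` and `M - 1`
  -- comparable.
  have hD : (M + 1) * t ≤ 16 * ‖a - b‖ ^ 2 := by
    have h1 : ((M - 1) * t) ^ 2 ≤ ‖a - b‖ ^ 2 * (4 * ((M + 1) * t)) := by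
      rw [← hprod, mul_pow]; gcongr
    have h2 : ((M + 1) * t) ^ 2 ≤ 4 * ((M - 1) * t) ^ 2 := by
      have : (M + 1) * t ≤ 2 * ((M - 1) * t) := by nlinarith
      calc ((M + 1) * t) ^ 2 ≤ (2 * ((M - 1) * t)) ^ 2 := by gcongr
        _ = _ := by ring
    have h3 : 0 < (M + 1) * t := by positivity
    refine le_of_mul_le_mul_right ?_ h3
    linarith
  have hre : (a.re * b.re) ^ 2 ≤ ((M + 1) * t) * (2 * t) := by
    calc (a.re * b.re) ^ 2 = |a.re| ^ 2 * |b.re| ^ 2 := by rw [mul_pow, sq_abs, sq_abs]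
      _ ≤ ‖a‖ ^ 2 * ‖b‖ ^ 2 := by gcongr <;> exact Complex.abs_re_le_norm _
      _ ≤ _ := by gcongr
  calc M * (a.re * b.re) ^ 2 ≤ (M + 1) * (((M + 1) * t) * (2 * t)) := by
        gcongr; linarith
    _ = 2 * ((M + 1) * t) ^ 2 := by ring
    _ ≤ 2 * (16 * ‖a - b‖ ^ 2) ^ 2 := by gcongr
    _ = _ := by ring

/-- A lower bound for the hyperbolic displacement along an orbit. -/
theorem IsKoenigs.orbit_lower_bound (hφ : IsSemigroup φ) (hh : IsKoenigs φ h) (hτ1 : ‖τ‖ = 1)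
    {p : ℂ} (hp : p ∉ h '' disc) {z : ℂ} (hz : z ∈ disc) {M t : ℝ} (hM : 3 ≤ M) (ht0 : 0 < t)
    (ht : ‖h z - p‖ ≤ t) :
    M * ((cayley τ (φ t.toNNReal z)).re ^ 2 * (cayley τ (φ (M * t).toNNReal z)).re ^ 2) ≤
      512 * ‖cayley τ (φ (M * t).toNNReal z) - cayley τ (φ t.toNNReal z)‖ ^ 4 := by
  set f : ℂ → ℂ := fun z => (-Complex.I * (h z - p)) ^ (1 / 2 : ℂ) with hf
  have hfd : DifferentiableOn ℂ f disc :=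
    ((hh.holo.sub_const _).const_mul _).cpow (differentiableOn_const _)
      fun z hz => hh.mem_slitPlane hφ hp hz
  have hfp : ∀ z ∈ disc, 0 < (f z).re := fun z hz => re_cpow_half_pos (hh.mem_slitPlane hφ hp hz)
  have hval : ∀ s : ℝ, 0 ≤ s →
      f (φ s.toNNReal z) = ((s : ℝ) + -Complex.I * (h z - p)) ^ (1 / 2 : ℂ) := by
    intro s hs
    simp only [hf]
    rw [hh.conj _ z hz, Real.coe_toNNReal _ hs]
    congr 1
    linear_combination (-(s : ℂ)) * Complex.I_sq
  have hMt : 0 < M * t := by positivity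
  have d1 := hφ.mapsTo (M * t).toNNReal hz
  have d2 := hφ.mapsTo t.toNNReal hz
  have key := schwarzPick_cayley hτ1 hfd hfp d1 d2
  have low := norm_cpow_half_sub_sq_lower (κ := -Complex.I * (h z - p)) (by simpa using ht) ht0 hM
  rw [← hval _ hMt.le, ← hval _ ht0.le] at low
  have r1 := cayley_re_pos hτ1 d1
  have r2 := cayley_re_pos hτ1 d2
  have f1 := hfp _ d1
  have f2 := hfp _ d2
  set x := (cayley τ (φ (M * t).toNNReal z)).re
  set y := (cayley τ (φ t.toNNReal z)).re
  set a := f (φ (M * t).toNNReal z)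
  set b := f (φ t.toNNReal z)
  set D := ‖cayley τ (φ (M * t).toNNReal z) - cayley τ (φ t.toNNReal z)‖
  refine le_of_mul_le_mul_right ?_ (pow_pos (mul_pos f1 f2) 2)
  calc M * (y ^ 2 * x ^ 2) * (a.re * b.re) ^ 2 = M * (a.re * b.re) ^ 2 * (x * y) ^ 2 := by ring
    _ ≤ 512 * ‖a - b‖ ^ 4 * (x * y) ^ 2 := by gcongr
    _ = 512 * (‖a - b‖ ^ 2 * (x * y)) ^ 2 := by ring
    _ ≤ 512 * (a.re * b.re * D ^ 2) ^ 2 := by gcongr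
    _ = _ := by ring

/-- The point at height `t` on the sector's axis is at distance `t * sin β` from its boundary. One
eighth of this absorbs the offset `w₀ - q` and another eighth is the radius. -/
theorem ball_subset_image_sector {β : ℝ} (hβ : β ∈ Set.Ioo 0 (Real.pi / 2)) (q w₀ : ℂ) {t : ℝ}
    (ht0 : 0 < t) (ht : ‖w₀ - q‖ ≤ Real.sin β / 8 * t) :
    ball (w₀ + Complex.I * t) (Real.sin β / 8 * t) ⊆
      (fun w : ℂ => q + Complex.I * w) '' sector β 0 := by
  intro w hw
  rw [mem_ball, dist_eq_norm] at hw
  have hsin : 0 < Real.sin β := Real.sin_pos_of_pos_of_lt_pi hβ.1 (by linarith [hβ.2, Real.pi_pos])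
  have hsin1 := Real.sin_le_one β
  set v : ℂ := -Complex.I * (w - q) with hv
  have hvt : ‖v - t‖ < Real.sin β / 4 * t := by
    have : v - t = -Complex.I * ((w - (w₀ + Complex.I * t)) + (w₀ - q)) := by
      rw [hv]; linear_combination (-(t : ℂ)) * Complex.I_sq
    rw [this, norm_mul, norm_neg, Complex.norm_I, one_mul]
    refine (norm_add_le _ _).trans_lt ?_
    linarith
  have him : |v.im| < Real.sin β / 4 * t := by
    have := Complex.abs_im_le_norm (v - t)
    simp only [Complex.sub_im, Complex.ofReal_im, sub_zero] at this
    linarith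
  have hre : 3 / 4 * t < v.re := by
    have := Complex.abs_re_le_norm (v - t)
    simp only [Complex.sub_re, Complex.ofReal_re] at this
    have h2 := (abs_le.1 this).1
    nlinarith
  have hv0 : v ≠ 0 := fun h0 => by rw [h0, Complex.zero_re] at hre; linarith
  have hvn : v.re ≤ ‖v‖ := Complex.re_le_norm v
  refine ⟨v, ⟨‖v‖, v.arg, norm_pos_iff.2 hv0, ?_, ?_⟩, ?_⟩
  · have hq : |v.im / ‖v‖| < Real.sin β := by
      rw [abs_div, abs_norm, div_lt_iff₀ (norm_pos_iff.2 hv0)]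
      nlinarith
    rw [abs_lt] at hq ⊢
    rw [Complex.arg_of_re_nonneg (by linarith)]
    constructor
    · rw [Real.lt_arcsin_iff_sin_lt' ⟨by linarith [hβ.2], by linarith [hβ.1, Real.pi_pos]⟩,
        Real.sin_neg]
      exact hq.1
    · rw [Real.arcsin_lt_iff_lt_sin' ⟨by linarith [hβ.1, Real.pi_pos], by linarith [hβ.2]⟩]
      exact hq.2
  · rw [mul_comm Complex.I, Complex.norm_mul_exp_arg_mul_I]
  · simp only [hv]
    linear_combination (-(w - q)) * Complex.I_sq

end Semigroup

/-! ### Hyperbolic estimates along orbits. -/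

section Orbits

variable {φ : ℝ≥0 → ℂ → ℂ} {h : ℂ → ℂ} {τ : ℂ}

/-- An upper bound for the hyperbolic distance of points of two orbits, from a Euclidean disc
contained in the image of the Koenigs function. -/
theorem IsKoenigs.norm_cayley_sub_mul_le (hφ : IsSemigroup φ) (hh : IsKoenigs φ h)
    (hτ1 : ‖τ‖ = 1) {z₁ z₂ : ℂ} (hz₁ : z₁ ∈ disc) (hz₂ : z₂ ∈ disc) {s t : ℝ≥0} {r : ℝ}
    (hball : ball (h z₂ + Complex.I * (t : ℝ)) r ⊆ h '' disc)
    (hr : ‖h z₁ + Complex.I * (s : ℝ) - (h z₂ + Complex.I * (t : ℝ))‖ < r) :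
    ‖cayley τ (φ s z₁) - cayley τ (φ t z₂)‖ *
        (r - ‖h z₁ + Complex.I * (s : ℝ) - (h z₂ + Complex.I * (t : ℝ))‖) ≤
      2 * ‖h z₁ + Complex.I * (s : ℝ) - (h z₂ + Complex.I * (t : ℝ))‖ *
        (cayley τ (φ t z₂)).re := by
  obtain ⟨g, hg, hgh⟩ := exists_differentiableOn_leftInverse isOpen_ball hh.holo hh.inj
  have hgm : Set.MapsTo g (h '' disc) disc := by
    rintro _ ⟨v, hv, rfl⟩
    rwa [hgh v hv]
  have key := norm_sub_mul_le_of_mapsTo_re_pos (F := cayley τ ∘ g)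
    (((differentiableOn_cayley hτ1).comp hg hgm).mono hball)
    (fun w hw => cayley_re_pos hτ1 (hgm (hball hw)))
    (w := h z₁ + Complex.I * (s : ℝ)) (by rwa [mem_ball, dist_eq_norm])
  simp only [Function.comp_apply] at key
  rw [← hh.conj s z₁ hz₁, ← hh.conj t z₂ hz₂, hgh _ (hφ.mapsTo s hz₁),
    hgh _ (hφ.mapsTo t hz₂)] at key
  rwa [hh.conj s z₁ hz₁, hh.conj t z₂ hz₂] at key

/-- If the image of the Koenigs function contains discs about the points of an orbit whose radii
grow linearly, then the orbit stays in a sector of the half-plane model. -/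
theorem IsKoenigs.exists_norm_cayley_le (hφ : IsSemigroup φ) (hτ : IsDenjoyWolffPoint φ τ)
    (hτ1 : ‖τ‖ = 1) (hh : IsKoenigs φ h) {z : ℂ} (hz : z ∈ disc) {c T : ℝ} (hc : 0 < c)
    (hball : ∀ t : ℝ, T ≤ t → ball (h z + Complex.I * t) (c * t) ⊆ h '' disc) :
    ∃ K, 0 < K ∧ ∀ᶠ t : ℝ≥0 in atTop,
      ‖cayley τ (φ t z)‖ ≤ K * (cayley τ (φ t z)).re := by
  obtain ⟨p, hp⟩ := hh.exists_notMem
  set t₀ : ℝ := max 1 (max T ‖h z - p‖) with ht₀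
  have h1t : 1 ≤ t₀ := le_max_left _ _
  have hTt : T ≤ t₀ := (le_max_left _ _).trans (le_max_right _ _)
  have hpt : ‖h z - p‖ ≤ t₀ := (le_max_right _ _).trans (le_max_right _ _)
  -- With ratio `1 + c / 2` a step covers at most half the radius `c * t`, which gives exactly the
  -- factor `2` in the step bound.
  obtain ⟨K, hK, hKG⟩ := exists_norm_le_mul_re (G := fun t => cayley τ (φ t.toNNReal z))
    (t₀ := t₀) (l := 1 + c / 2) (B := 512) (by linarith) (by linarith)
    (fun t _ => cayley_re_pos hτ1 (hφ.mapsTo _ hz))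
    (fun s t _ hst => hφ.cayley_re_mono hτ hτ1 (Real.toNNReal_le_toNNReal hst) hz)
    (by
      intro s t ht hts hs
      have ht0 : 0 < t := by linarith
      have hx := cayley_re_pos hτ1 (hφ.mapsTo t.toNNReal hz)
      have hs' : ((s.toNNReal : ℝ≥0) : ℝ) = s := Real.coe_toNNReal _ (by linarith)
      have ht' : ((t.toNNReal : ℝ≥0) : ℝ) = t := Real.coe_toNNReal _ (by linarith)
      have hn : ‖h z + Complex.I * ((s.toNNReal : ℝ≥0) : ℝ) -
          (h z + Complex.I * ((t.toNNReal : ℝ≥0) : ℝ))‖ = s - t := by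
        rw [hs', ht', add_sub_add_left_eq_sub, ← mul_sub, ← Complex.ofReal_sub, norm_mul,
          Complex.norm_I, one_mul, Complex.norm_real, Real.norm_of_nonneg (by linarith)]
      have hct : 0 < c * t := by positivity
      have key := hh.norm_cayley_sub_mul_le hφ hτ1 hz hz (s := s.toNNReal) (t := t.toNNReal)
        (r := c * t) (by rw [ht']; exact hball t (hTt.trans ht)) (by rw [hn]; linarith)
      rw [hn] at key
      have h2 : c * t / 2 ≤ c * t - (s - t) := by linarith
      have h3 : 2 * (s - t) ≤ c * t := by linarith
      have h4 := (mul_le_mul_of_nonneg_left h2 (norm_nonneg _)).trans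
        (key.trans (mul_le_mul_of_nonneg_right h3 hx.le))
      refine le_of_mul_le_mul_right ?_ (half_pos hct)
      linarith)
    (fun M t hM ht => hh.orbit_lower_bound hφ hτ1 hp hz hM (by linarith) (hpt.trans ht))
  refine ⟨K, hK, ?_⟩
  filter_upwards [eventually_ge_atTop t₀.toNNReal] with t ht
  have := hKG t (Real.toNNReal_le_iff_le_coe.1 ht)
  simpa using this

/-- An orbit staying in a sector of the half-plane model eventually stays in a Stolz region. -/
theorem eventually_mem_stolz (hφ : IsSemigroup φ) (hτ : IsDenjoyWolffPoint φ τ)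
    (hτ1 : ‖τ‖ = 1) {z : ℂ} (hz : z ∈ disc) {K : ℝ} (hK : 0 < K)
    (hb : ∀ᶠ t : ℝ≥0 in atTop, ‖cayley τ (φ t z)‖ ≤ K * (cayley τ (φ t z)).re) :
    ∀ᶠ t in atTop, φ t z ∈ stolz τ (2 * K + 2) := by
  -- The numerator of the Cayley transform eventually exceeds `1` in norm, so the sector bound
  -- yields `‖τ - φ t z‖ ≤ K * (1 - ‖φ t z‖ ^ 2)`.
  have hlim : Tendsto (fun t => ‖1 + conj τ * φ t z‖) atTop (𝓝 2) := by
    have h1 := (((hτ.tendsto hz).const_mul (conj τ)).const_add 1).norm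
    have h2 : ‖1 + conj τ * τ‖ = 2 := by
      rw [mul_comm, Complex.mul_conj, Complex.normSq_eq_norm_sq, hτ1]; norm_num
    rwa [h2] at h1
  filter_upwards [hb, hlim.eventually (lt_mem_nhds one_lt_two)] with t h1 h2
  have hd := hφ.mapsTo t hz
  have hn : ‖φ t z‖ < 1 := by simpa using hd
  have q := norm_pos_iff.2 (one_sub_conj_mul_ne_zero hτ1 hd)
  rw [norm_one_sub_conj_mul hτ1] at q
  rw [cayley_re hτ1, cayley, norm_div, norm_one_sub_conj_mul hτ1, div_le_iff₀ q] at h1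
  refine ⟨hd, ?_⟩
  have h3 : K * ((1 - ‖φ t z‖ ^ 2) / ‖τ - φ t z‖ ^ 2) * ‖τ - φ t z‖ =
      K * (1 - ‖φ t z‖ ^ 2) / ‖τ - φ t z‖ := by field_simp
  rw [h3, le_div_iff₀ q] at h1
  have h4 : ‖τ - φ t z‖ ≤ ‖1 + conj τ * φ t z‖ * ‖τ - φ t z‖ :=
    le_mul_of_one_le_left q.le h2.le
  have h5 : 1 - ‖φ t z‖ ^ 2 ≤ 2 * (1 - ‖φ t z‖) := by nlinarith [sq_nonneg (1 - ‖φ t z‖)]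
  have h6 := mul_le_mul_of_nonneg_left h5 hK.le
  nlinarith

theorem re_one_sub_conj_mul_pos (hτ1 : ‖τ‖ = 1) {z : ℂ} (hz : z ∈ disc) :
    1 - ‖z‖ ≤ (1 - conj τ * z).re ∧ 0 < (1 - conj τ * z).re := by
  have hn : ‖z‖ < 1 := by simpa using hz
  have h1 : (conj τ * z).re ≤ ‖z‖ := by
    refine (Complex.re_le_norm _).trans ?_
    rw [norm_mul, RCLike.norm_conj, hτ1, one_mul]
  rw [Complex.sub_re, Complex.one_re]
  constructor <;> linarith

/-- The cosine of the argument is at least `(1 - ‖z‖) / ‖τ - z‖`, which a Stolz region bounds below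
by `1 / R`. -/
theorem abs_arg_le_of_mem_stolz (hτ1 : ‖τ‖ = 1) {z : ℂ} {R : ℝ} (hR : 0 < R)
    (hz : z ∈ stolz τ R) : |(1 - conj τ * z).arg| ≤ Real.arccos (1 / R) := by
  obtain ⟨hzd, hlt⟩ := hz
  obtain ⟨h1, h2⟩ := re_one_sub_conj_mul_pos hτ1 hzd
  rw [← norm_one_sub_conj_mul hτ1] at hlt
  have hne : 1 - conj τ * z ≠ 0 := one_sub_conj_mul_ne_zero hτ1 hzd
  have hpos := norm_pos_iff.2 hne
  have hcos : 1 / R ≤ Real.cos |(1 - conj τ * z).arg| := by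
    rw [Real.cos_abs, Complex.cos_arg hne, div_le_div_iff₀ hR hpos]
    nlinarith
  have h3 := Real.arccos_le_arccos hcos
  rwa [Real.arccos_cos (abs_nonneg _) (Complex.abs_arg_le_pi _)] at h3

/-- The arguments along two orbits are asymptotic if the image of the Koenigs function contains
discs about the points of one of them whose radii grow linearly. -/
theorem IsKoenigs.tendsto_arg_sub (hφ : IsSemigroup φ) (hh : IsKoenigs φ h) (hτ1 : ‖τ‖ = 1)
    {z₁ z₂ : ℂ} (hz₁ : z₁ ∈ disc) (hz₂ : z₂ ∈ disc) {c T : ℝ} (hc : 0 < c)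
    (hball : ∀ t : ℝ, T ≤ t → ball (h z₂ + Complex.I * t) (c * t) ⊆ h '' disc) :
    Tendsto (fun t => (1 - conj τ * φ t z₂).arg - (1 - conj τ * φ t z₁).arg) atTop (𝓝 0) := by
  have hcay : ∀ {z : ℂ}, z ∈ disc → (1 - conj τ * z)⁻¹ = (cayley τ z + 1) / 2 := by
    intro z hz
    have := one_sub_conj_mul_ne_zero hτ1 hz
    rw [cayley, div_add_one this]
    field_simp
    ring
  set δ := ‖h z₁ - h z₂‖
  have hct : Tendsto (fun t : ℝ≥0 => c * (t : ℝ)) atTop atTop :=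
    (NNReal.tendsto_coe_atTop.2 tendsto_id).const_mul_atTop hc
  have hratio : Tendsto (fun t => (1 - conj τ * φ t z₂) / (1 - conj τ * φ t z₁)) atTop (𝓝 1) := by
    rw [tendsto_iff_norm_sub_tendsto_zero]
    -- The Schwarz bound for points at distance `δ` in a disc of radius `c * t`, relative to the
    -- real part at its centre.
    have hlim : Tendsto (fun t : ℝ≥0 => 2 * δ / (c * t - δ)) atTop (𝓝 0) :=
      tendsto_const_nhds.div_atTop (tendsto_atTop_add_const_right _ (-δ) hct)
    refine squeeze_zero' (Eventually.of_forall fun _ => norm_nonneg _) ?_ hlim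
    filter_upwards [hct.eventually_gt_atTop δ, eventually_ge_atTop T.toNNReal] with t ht hT
    have d1 := hφ.mapsTo t hz₁
    have d2 := hφ.mapsTo t hz₂
    have hn : ‖h z₁ + Complex.I * (t : ℝ) - (h z₂ + Complex.I * (t : ℝ))‖ = δ := by
      rw [add_sub_add_right_eq_sub]
    have key := hh.norm_cayley_sub_mul_le hφ hτ1 hz₁ hz₂ (s := t) (t := t)
      (hball t (Real.toNNReal_le_iff_le_coe.1 hT)) (by rw [hn]; exact ht)
    rw [hn] at key
    have hx := cayley_re_pos hτ1 d2
    have hx1 : (cayley τ (φ t z₂)).re ≤ ‖cayley τ (φ t z₂) + 1‖ := by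
      refine le_trans ?_ (Complex.re_le_norm _)
      simp
    have hne : cayley τ (φ t z₂) + 1 ≠ 0 := norm_pos_iff.1 (hx.trans_le hx1)
    have e : (1 - conj τ * φ t z₂) / (1 - conj τ * φ t z₁) - 1 =
        (cayley τ (φ t z₁) - cayley τ (φ t z₂)) / (cayley τ (φ t z₂) + 1) := by
      rw [div_eq_mul_inv, hcay d1, ← inv_inv (1 - conj τ * φ t z₂), hcay d2]
      field_simp
      ring
    rw [e, norm_div, div_le_div_iff₀ (norm_pos_iff.2 hne) (by linarith)]
    refine key.trans ?_
    have : 0 ≤ 2 * δ := by positivity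
    gcongr
  have harg : Tendsto (fun t => ((1 - conj τ * φ t z₂) / (1 - conj τ * φ t z₁)).arg) atTop
      (𝓝 0) := by
    have := (Complex.continuousAt_arg Complex.one_mem_slitPlane).tendsto.comp hratio
    rwa [Complex.arg_one] at this
  refine harg.congr fun t => ?_
  have d1 := hφ.mapsTo t hz₁
  have d2 := hφ.mapsTo t hz₂
  have a1 := abs_lt.1 (Complex.abs_arg_lt_pi_div_two_iff.2
    (Or.inl (re_one_sub_conj_mul_pos hτ1 d1).2))
  have a2 := abs_lt.1 (Complex.abs_arg_lt_pi_div_two_iff.2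
    (Or.inl (re_one_sub_conj_mul_pos hτ1 d2).2))
  have n1 := one_sub_conj_mul_ne_zero hτ1 d1
  have n2 := one_sub_conj_mul_ne_zero hτ1 d2
  have hinv : (1 - conj τ * φ t z₁)⁻¹.arg = -(1 - conj τ * φ t z₁).arg := by
    rw [Complex.arg_inv, if_neg (by linarith [Real.pi_pos])]
  -- Both arguments lie strictly between `-π / 2` and `π / 2`, so their difference needs no
  -- correction by `2π`.
  rw [div_eq_mul_inv, Complex.arg_mul n2 (inv_ne_zero n1), hinv]
  · ring
  · rw [hinv]
    constructor <;> linarith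

end Orbits

end DiscSemigroup

/-! ### The main theorem. -/

open Filter Topology Metric DiscSemigroup in
theorem corollary1p2 (φ : ℝ≥0 → ℂ → ℂ) (h : ℂ → ℂ) (τ : ℂ)
    (hφ : DiscSemigroup.IsSemigroup φ)
    (hne : DiscSemigroup.IsNonElliptic φ)
    (hτ : DiscSemigroup.IsDenjoyWolffPoint φ τ)
    (hh : DiscSemigroup.IsKoenigs φ h)
    (β : ℝ) (hβ : β ∈ Set.Ioo 0 (Real.pi / 2)) (q : ℂ)
    (hq : (fun w : ℂ => q + Complex.I * w) '' DiscSemigroup.sector β 0 ⊆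
      h '' DiscSemigroup.disc) :
    (∀ z ∈ DiscSemigroup.disc,
      DiscSemigroup.TendsToNonTangentially (fun t => φ t z) τ) ∧
    ∃ a b : ℝ, -(Real.pi / 2) < a ∧ a ≤ b ∧ b < Real.pi / 2 ∧
      ∀ z ∈ DiscSemigroup.disc, DiscSemigroup.slope φ τ z = Set.Icc a b := by
  have hτ1 : ‖τ‖ = 1 := hne.norm_eq_one hτ
  have hsin : 0 < Real.sin β / 8 := by
    have := Real.sin_pos_of_pos_of_lt_pi hβ.1 (by linarith [hβ.2, Real.pi_pos])
    positivity
  have hball : ∀ z, ∃ T : ℝ, ∀ t : ℝ, T ≤ t →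
      ball (h z + Complex.I * t) (Real.sin β / 8 * t) ⊆ h '' disc := by
    intro z
    refine ⟨max 1 (‖h z - q‖ / (Real.sin β / 8)), fun t ht => ?_⟩
    have h1 := (le_max_left _ _).trans ht
    have h2 := (le_max_right _ _).trans ht
    rw [div_le_iff₀' hsin] at h2
    exact (ball_subset_image_sector hβ q (h z) (by linarith) h2).trans hq
  have hstolz : ∀ z ∈ disc, ∃ R : ℝ, 1 < R ∧ ∀ᶠ t in atTop, φ t z ∈ stolz τ R := by
    intro z hz
    obtain ⟨T, hT⟩ := hball z
    obtain ⟨K, hK, hb⟩ := hh.exists_norm_cayley_le hφ hτ hτ1 hz hsin hT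
    exact ⟨2 * K + 2, by linarith, eventually_mem_stolz hφ hτ hτ1 hz hK hb⟩
  refine ⟨fun z hz => ⟨by simpa using hτ1, hτ.tendsto hz, hstolz z hz⟩, ?_⟩
  have h0 : (0 : ℂ) ∈ disc := mem_ball_self one_pos
  -- The orbit of `0` alone fixes the interval; its Stolz amplitude keeps the endpoints away from
  -- `±π / 2`.
  obtain ⟨R, hR1, hR⟩ := hstolz 0 h0
  set f : ℝ≥0 → ℝ := fun t => Complex.arg (1 - (starRingEnd ℂ) τ * φ t 0)
  have hf : Continuous f := by
    refine continuous_iff_continuousAt.2 fun t => ?_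
    have hc : Continuous fun t => 1 - (starRingEnd ℂ) τ * φ t 0 :=
      continuous_const.sub (continuous_const.mul (hφ.continuous_orbit h0))
    exact ContinuousAt.comp (g := Complex.arg) (Complex.continuousAt_arg
      (Complex.mem_slitPlane_iff.2 (Or.inl (re_one_sub_conj_mul_pos hτ1 (hφ.mapsTo t h0)).2)))
      hc.continuousAt
  have hα : Real.arccos (1 / R) < Real.pi / 2 :=
    Real.arccos_lt_pi_div_two.2 (by positivity)
  have hbd : ∀ᶠ t in atTop, |f t| ≤ Real.arccos (1 / R) :=
    hR.mono fun t ht => abs_arg_le_of_mem_stolz hτ1 (by linarith) ht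
  have hlo : ∀ᶠ t in atTop, -Real.arccos (1 / R) ≤ f t := hbd.mono fun t ht => (abs_le.1 ht).1
  have hup : ∀ᶠ t in atTop, f t ≤ Real.arccos (1 / R) := hbd.mono fun t ht => (abs_le.1 ht).2
  have hbl : IsBoundedUnder (· ≥ ·) atTop f := ⟨_, by simpa using hlo⟩
  have hbu : IsBoundedUnder (· ≤ ·) atTop f := ⟨_, by simpa using hup⟩
  refine ⟨liminf f atTop, limsup f atTop, ?_, liminf_le_limsup hbu hbl, ?_, fun z hz => ?_⟩
  · have := le_liminf_of_le hbu.isCoboundedUnder_ge hlo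
    linarith
  · have := limsup_le_of_le hbl.isCoboundedUnder_le hup
    linarith
  · ext y
    rw [← mapClusterPt_atTop_iff hf hlo hup]
    obtain ⟨T, hT⟩ := hball z
    obtain ⟨T', hT'⟩ := hball 0
    exact ⟨mapClusterPt_of_tendsto_sub (hh.tendsto_arg_sub hφ hτ1 h0 hz hsin hT),
      mapClusterPt_of_tendsto_sub (hh.tendsto_arg_sub hφ hτ1 hz h0 hsin hT')⟩
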